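/- Let $S=\mathbb{C}[x_0,\dots,x_n]$ with its standard grading, let $\Omega^r_S$ be the module of algebraic differential $r$-forms on $\mathbb{C}^{n+1}$, and let $T_S$ be the module of polynomial vector fields. Let $e\ge 2$ and let $\omega\in\mathcal{F}^1(\mathbb{P}^n,e)$ be a codimension one foliation, that is, a nonzero global section $\omega=\sum_{i=0}^n A_i\,dx_i$ of $\Omega^1_{\mathbb{P}^n}(e)$ (the $A_i\in S$ are homogeneous of degree $e-1$ and $\sum_i x_iA_i=0$) such that $\omega\wedge d\omega=0$ and the singular scheme $\mathrm{sing}(\omega)\subseteq\mathbb{P}^n$, defined by $A_0,\dots,A_n$, has codimension at least $2$. Define the following ideals of $S$: \[ J=\{i_X\omega : X\in T_S\}=(A_0,\dots,A_n),\qquad I=\{h\in S : h\,d\omega=\omega\wedge\eta\ \text{for some}\ \eta\in\Omega^1_S\}, \] \[ K=\mathrm{ann}(\overline{d\omega})+J,\ \text{ where }\overline{d\omega}\text{ is the class of } d\omega \text{ in } \Omega^2_S\otimes_S S/J,\qquad L=(J:K^\infty)=\bigcup_{d\ge 1}(J:K^d), \] and let $\mathcal{K}=\mathrm{Proj}(S/K)$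 and $\mathcal{L}=\mathrm{Proj}(S/L)$ be the Kupka and the non-Kupka subschemes of $\mathbb{P}^n$. If $J$ is a radical ideal and $\mathcal{K}\cap\mathcal{L}=\emptyset$, then $I=K$. -/

import Mathlib

open scoped KaehlerDifferential TensorProduct

attribute [local instance] MvPolynomial.gradedAlgebra

noncomputable section

namespace Foliation

/-- The homogeneous coordinate ring `S = ℂ[x₀, …, xₙ]` of `ℙⁿ`. -/
abbrev S (n : ℕ) : Type := MvPolynomial (Fin (n + 1)) ℂ

/-- Algebraic differential 1-forms on the affine cone `ℂⁿ⁺¹`. -/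
abbrev Form1 (n : ℕ) : Type := Ω[S n⁄ℂ]

/-- Algebraic differential 2-forms on the affine cone `ℂⁿ⁺¹`. -/
abbrev Form2 (n : ℕ) : Type := ⋀[S n]^2 (Form1 n)

/-- The algebra of all algebraic differential forms; its product is the wedge product. -/
abbrev Forms (n : ℕ) : Type := ExteriorAlgebra (S n) (Form1 n)

/-- The coefficient `Aᵢ` of `ω = ∑ i, Aᵢ dxᵢ`. -/
def coefficient {n : ℕ} (ω : Form1 n) (i : Fin (n + 1)) : S n :=
  (KaehlerDifferential.mvPolynomialBasis ℂ (Fin (n + 1))).repr ω i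

/-- The differential `df` of a polynomial. -/
def diff {n : ℕ} (f : S n) : Form1 n := KaehlerDifferential.D ℂ (S n) f

/-- The exterior differential of a 1-form: `d (∑ i, Aᵢ dxᵢ) = ∑ i, dAᵢ ∧ dxᵢ`. -/
def extDiff {n : ℕ} (ω : Form1 n) : Form2 n :=
  ∑ i, exteriorPower.ιMulti (S n) 2 ![diff (coefficient ω i), diff (MvPolynomial.X i)]

/-- The contraction `i_X ω` of a 1-form with a polynomial vector field,
as a linear function of the vector field `X`. -/
def contract {n : ℕ} (ω : Form1 n) : Derivation ℂ (S n) (S n) →ₗ[S n] S n :=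
  (LinearMap.applyₗ ω).comp
    (KaehlerDifferential.linearMapEquivDerivation ℂ (S n)).symm.toLinearMap

/-- The radial vector field `R = ∑ i, xᵢ ∂/∂xᵢ`. -/
def radial (n : ℕ) : Derivation ℂ (S n) (S n) :=
  MvPolynomial.mkDerivation ℂ MvPolynomial.X

/-- `ℙⁿ` as the set of homogeneous prime ideals of `S` not containing the irrelevant ideal. -/
abbrev ProjSpace (n : ℕ) : Type :=
  ProjectiveSpectrum (MvPolynomial.homogeneousSubmodule (Fin (n + 1)) ℂ)

/-- The set of points of the closed subscheme `Proj (S / 𝔞)` of `ℙⁿ`, for an ideal `𝔞` of `S`. -/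
def projLocus {n : ℕ} (𝔞 : Ideal (S n)) : Set (ProjSpace n) :=
  ProjectiveSpectrum.zeroLocus (MvPolynomial.homogeneousSubmodule (Fin (n + 1)) ℂ) (𝔞 : Set (S n))

/-- The singular ideal `J(ω) = {i_X ω : X ∈ T_S}`, where `T_S` is the module of polynomial vector
fields. -/
def singularIdeal {n : ℕ} (ω : Form1 n) : Ideal (S n) :=
  LinearMap.range (contract ω)

/-- `ω` is a generator of a codimension one foliation on `ℙⁿ` belonging to `ℱ¹(ℙⁿ, e)`: a nonzero
global section of `Ω¹_{ℙⁿ}(e)`, `e ≥ 2`, that is integrable and whose singular scheme has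
codimension at least `2` in `ℙⁿ` (the codimension of a closed subset being the least height of the
points of it). -/
structure IsFoliation (n e : ℕ) (ω : Form1 n) : Prop where
  two_le : 2 ≤ e
  ne_zero : ω ≠ 0
  homogeneous : ∀ i, (coefficient ω i).IsHomogeneous (e - 1)
  descends : contract ω (radial n) = 0
  integrable : ExteriorAlgebra.ι (S n) ω * (extDiff ω : Forms n) = 0
  codim : ∀ p ∈ projLocus (singularIdeal ω), 2 ≤ p.asHomogeneousIdeal.toIdeal.height

/-- The ideal of unfoldings `I(ω) = {h ∈ S : h dω = ω ∧ η for some η ∈ Ω¹_S}`. -/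
def unfoldingIdeal {n : ℕ} (ω : Form1 n) : Ideal (S n) where
  carrier := {h | ∃ η : Form1 n,
    h • (extDiff ω : Forms n) = ExteriorAlgebra.ι (S n) ω * ExteriorAlgebra.ι (S n) η}
  zero_mem' := ⟨0, by simp⟩
  add_mem' := by
    rintro a b ⟨η, hη⟩ ⟨θ, hθ⟩
    exact ⟨η + θ, by rw [add_smul, hη, hθ, map_add, mul_add]⟩
  smul_mem' := by
    rintro c a ⟨η, hη⟩
    exact ⟨c • η, by rw [smul_eq_mul, mul_smul, hη, map_smul, mul_smul_comm]⟩

/-- The ideal `K(ω) = ann(dω̄) + J(ω)` of the Kupka scheme, where `dω̄` is the class of `dω` in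
`Ω²_S ⊗ S/J(ω)`. -/
def kupkaIdeal {n : ℕ} (ω : Form1 n) : Ideal (S n) :=
  Ideal.torsionOf (S n) (Form2 n ⊗[S n] (S n ⧸ singularIdeal ω))
    (extDiff ω ⊗ₜ[S n] (1 : S n ⧸ singularIdeal ω)) ⊔ singularIdeal ω

/-- The saturation `(𝔞 : 𝔟^∞) = ⋃_{d ≥ 1} (𝔞 : 𝔟^d)`. -/
def saturation {n : ℕ} (𝔞 𝔟 : Ideal (S n)) : Ideal (S n) where
  carrier := {a | ∃ d : ℕ, 1 ≤ d ∧ ∀ b ∈ 𝔟 ^ d, a * b ∈ 𝔞}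
  zero_mem' := ⟨1, le_rfl, fun b _ => by simp⟩
  add_mem' := by
    rintro x y ⟨d, hd, hx⟩ ⟨k, hk, hy⟩
    refine ⟨d + k, by omega, fun b hb => ?_⟩
    rw [add_mul]
    exact 𝔞.add_mem (hx b (Ideal.pow_le_pow_right (by omega) hb))
      (hy b (Ideal.pow_le_pow_right (by omega) hb))
  smul_mem' := by
    rintro c x ⟨d, hd, hx⟩
    refine ⟨d, hd, fun b hb => ?_⟩
    rw [smul_eq_mul, mul_assoc]
    exact 𝔞.mul_mem_left c (hx b hb)

/-- The ideal `L(ω) = (J(ω) : K(ω)^∞)` of the non-Kupka scheme. -/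
def nonKupkaIdeal {n : ℕ} (ω : Form1 n) : Ideal (S n) :=
  saturation (singularIdeal ω) (kupkaIdeal ω)

end Foliation

end

/-! For `h ∈ K` the form `θ = h dω` has coefficients in `J`, and integrability gives `ω ∧ θ = 0`;
the point is to divide `θ` by `ω`. Since `J` has height at least two, it contains a regular sequence
`a = i_X ω`, `b = i_Y ω`, and `θ` is divisible once `g = θ(X, Y)` lies in `(a, b)`
(`exists_wedge_of_contraction_mem`).

Suppose it does not. As `J g ⊆ (a, b)`, some associated prime `Q` of `S/(a, b)` contains both `((a,
b) : g)` and `J`. The ring `S_Q` is regular of depth two, so its maximal ideal is generated by a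
regular pair (`RegularFlag.exists_maximalIdeal_eq_span_pair`), and the radical ideal `J` localizes
to that whole ideal. The divisibility criterion for the new pair holds because `θ` has coefficients
in `J`. So `θ` is divisible over `S_Q`, which puts `g` in `(a, b) S_Q`, a contradiction.

Regularity enters through flags of primes, built by induction on the number of variables. -/

namespace Foliation

/-! ### Division criterion and depth two -/

/-- If `a, b` is a weakly regular sequence of combinations of the entries of `A`, a 2-form `θ` with
`A ∧ θ = 0` is divisible by `A` as soon as its contraction with the two combinations lies in
`(a, b)`. -/
theorem exists_wedge_of_contraction_mem {R ι : Type*} [CommRing R] [IsDomain R] [Fintype ι]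
    {A : ι → R} {θ : ι → ι → R} (hskew : ∀ i j, θ i j = -θ j i)
    (hcyc : ∀ i j k, A i * θ j k - A j * θ i k + A k * θ i j = 0)
    {X Y : ι → R} {a b : R} (ha : a = ∑ i, X i * A i) (hb : b = ∑ i, Y i * A i) (ha0 : a ≠ 0)
    (hreg : ∀ z, a ∣ b * z → a ∣ z)
    (hg : ∑ i, ∑ j, X i * Y j * θ i j ∈ Ideal.span {a, b}) :
    ∃ η : ι → R, ∀ i j, θ i j = A i * η j - A j * η i := by
  obtain ⟨u, v, huv⟩ := Ideal.mem_span_pair.1 hg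
  set p : ι → R := fun k => ∑ i, X i * θ i k with hp
  set q : ι → R := fun k => ∑ i, Y i * θ i k with hq
  have hap : ∀ j k, a * θ j k = A j * p k - A k * p j := by
    intro j k
    rw [ha, hp, Finset.sum_mul, Finset.mul_sum, Finset.mul_sum, ← Finset.sum_sub_distrib]
    refine Finset.sum_congr rfl fun i _ => ?_
    linear_combination X i * hcyc i j k
  have hbq : ∀ j k, b * θ j k = A j * q k - A k * q j := by
    intro j k
    rw [hb, hq, Finset.sum_mul, Finset.mul_sum, Finset.mul_sum, ← Finset.sum_sub_distrib]
    refine Finset.sum_congr rfl fun i _ => ?_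
    linear_combination Y i * hcyc i j k
  -- Skew-symmetry only gives `2 θ(X, X) = 0`; contracting `a θ = A ∧ p` twice with `X` works in any
  -- characteristic.
  have hXp : ∑ j, X j * p j = 0 := by
    refine (mul_eq_zero.1 (?_ : a * _ = 0)).resolve_left ha0
    have h1 : ∀ j, a * (X j * p j) = X j * ∑ i, X i * (A i * p j - A j * p i) := by
      intro j
      rw [hp, mul_left_comm, Finset.mul_sum]
      refine congrArg _ (Finset.sum_congr rfl fun i _ => ?_)
      rw [mul_left_comm, hap]
    have h2 : ∀ j, ∑ i, X i * (A i * p j - A j * p i) = a * p j - A j * ∑ i, X i * p i := by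
      intro j
      rw [ha, Finset.sum_mul, Finset.mul_sum, ← Finset.sum_sub_distrib]
      exact Finset.sum_congr rfl fun i _ => by ring
    have h3 : ∑ j, a * (X j * p j) = a * ∑ j, X j * p j - a * ∑ i, X i * p i := by
      simp only [h1, h2]
      nth_rewrite 3 [ha]
      rw [Finset.mul_sum, Finset.sum_mul, ← Finset.sum_sub_distrib]
      exact Finset.sum_congr rfl fun i _ => by ring
    rw [Finset.mul_sum, h3, sub_self]
  have hXq : ∑ j, X j * q j = -(u * a + v * b) := by
    rw [huv, ← Finset.sum_neg_distrib]
    refine Finset.sum_congr rfl fun i _ => ?_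
    rw [hq, Finset.mul_sum, ← Finset.sum_neg_distrib]
    refine Finset.sum_congr rfl fun j _ => ?_
    rw [hskew j i]; ring
  -- Both `A ∧ b p` and `A ∧ a q` equal `a b θ`, so `b p - a q` is proportional to `A`; contraction
  -- with `X` finds the factor `g`.
  have hγ : ∀ k, b * p k - a * q k = (u * a + v * b) * A k := by
    intro k
    apply mul_left_cancel₀ ha0
    have h1 : a * (b * p k - a * q k) = ∑ j, X j * (A k * (b * p j - a * q j)) := by
      nth_rewrite 1 [ha]
      rw [Finset.sum_mul]
      refine Finset.sum_congr rfl fun j _ => ?_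
      linear_combination X j * a * hbq j k - X j * b * hap j k
    have h2 : ∑ j, X j * (A k * (b * p j - a * q j))
        = A k * (b * ∑ j, X j * p j - a * ∑ j, X j * q j) := by
      rw [Finset.mul_sum, Finset.mul_sum, ← Finset.sum_sub_distrib, Finset.mul_sum]
      exact Finset.sum_congr rfl fun i _ => by ring
    rw [h1, h2, hXp, hXq]; ring
  have hdvd : ∀ k, a ∣ p k - v * A k := fun k =>
    hreg _ ⟨q k + u * A k, by linear_combination hγ k⟩
  choose η hη using hdvd
  refine ⟨η, fun j k => mul_left_cancel₀ ha0 ?_⟩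
  linear_combination hap j k + A j * hη k - A k * hη j

/-- Independence of the choice of a maximal regular sequence, in length two: if an element is moved
into `(a, b)` by a weakly regular sequence of length three, it lies in `(a, b)`. -/
theorem mem_span_pair_of_regular_triple {R : Type*} [CommRing R] [IsDomain R] {a b s₁ s₂ s₃ g : R}
    (ha : a ≠ 0) (hb : b ≠ 0) (hs : s₁ ≠ 0) (hab : ∀ z, a ∣ b * z → a ∣ z)
    (h₂ : ∀ z, s₁ ∣ s₂ * z → s₁ ∣ z)
    (h₃ : ∀ z, s₃ * z ∈ Ideal.span {s₁, s₂} → z ∈ Ideal.span {s₁, s₂})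
    (hg₁ : s₁ * g ∈ Ideal.span {a, b}) (hg₂ : s₂ * g ∈ Ideal.span {a, b})
    (hg₃ : s₃ * g ∈ Ideal.span {a, b}) : g ∈ Ideal.span {a, b} := by
  obtain ⟨p₁, q₁, e₁⟩ := Ideal.mem_span_pair.1 hg₁
  obtain ⟨p₂, q₂, e₂⟩ := Ideal.mem_span_pair.1 hg₂
  obtain ⟨p₃, q₃, e₃⟩ := Ideal.mem_span_pair.1 hg₃
  -- Two expressions of `s t g` differ by a syzygy of `(a, b)`, which is a multiple `u` of the
  -- Koszul one.
  have key : ∀ {s t p q p' q' : R}, p * a + q * b = s * g → p' * a + q' * b = t * g →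
      ∃ u, t * p - s * p' = b * u ∧ s * q' - t * q = a * u := by
    intro s t p q p' q' e e'
    obtain ⟨u, hu⟩ := hab (s * q' - t * q) ⟨t * p - s * p', by linear_combination s * e' - t * e⟩
    refine ⟨u, mul_left_cancel₀ ha ?_, hu⟩
    linear_combination t * e - s * e' + b * hu
  obtain ⟨u, hu, hu'⟩ := key e₁ e₂
  obtain ⟨v, hv, -⟩ := key e₁ e₃
  obtain ⟨w, hw, -⟩ := key e₂ e₃
  have h0 : s₃ * u - s₂ * v + s₁ * w = 0 := by
    refine (mul_eq_zero.1 (?_ : b * _ = 0)).resolve_left hb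
    linear_combination s₂ * hv - s₁ * hw - s₃ * hu
  -- Writing `u = α s₁ + β s₂` allows correcting `p₁, q₁` by multiples of `b, a` until `s₁` divides
  -- both.
  obtain ⟨α, β, hαβ⟩ := Ideal.mem_span_pair.1
    (h₃ u (Ideal.mem_span_pair.2 ⟨-w, v, by linear_combination -h0⟩))
  obtain ⟨c, hc⟩ := h₂ (p₁ - β * b) ⟨p₂ + α * b, by linear_combination hu - b * hαβ⟩
  obtain ⟨c', hc'⟩ := h₂ (q₁ + β * a) ⟨q₂ - α * a, by linear_combination -hu' + a * hαβ⟩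
  refine Ideal.mem_span_pair.2 ⟨c, c', mul_left_cancel₀ hs ?_⟩
  linear_combination e₁ - a * hc - b * hc'

/-! ### Regular flags in polynomial rings -/

/-- A flag of primes `⊥ = P₀ ⊂ P₁ ⊂ ⋯ ⊂ Pₖ ⊆ Q` in which, after localizing at `Q`, each term is
generated by the preceding one and one further element. -/
inductive RegularFlag {R : Type*} [CommRing R] (Q : Ideal R) : ℕ → Ideal R → Prop
  | bot : RegularFlag Q 0 ⊥
  | cons {k : ℕ} {P P' : Ideal R} {s : R} : RegularFlag Q k P → P.IsPrime → P'.IsPrime →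
      P ≤ P' → P' ≤ Q → s ∈ P' → s ∉ P →
      (∀ x ∈ P', ∃ t ∉ Q, t * x ∈ P ⊔ Ideal.span {s}) →
      RegularFlag Q (k + 1) P'

/-- Every prime of `R` is the last term of a regular flag. -/
def HasRegularFlags (R : Type*) [CommRing R] : Prop :=
  ∀ Q : Ideal R, Q.IsPrime → ∃ k, RegularFlag Q k Q

/-- Serves both `R → R[X]` and localization. Multipliers outside `Q'` are closed under products, so
the generation condition need only be checked on generators. -/
theorem RegularFlag.map {R R' : Type*} [CommRing R] [CommRing R'] (f : R →+* R') {Q : Ideal R}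
    {Q' : Ideal R'} [hQ' : Q'.IsPrime] (hQ : Q.map f ≤ Q') (hcompl : ∀ t ∉ Q, f t ∉ Q')
    (hprime : ∀ P : Ideal R, P.IsPrime → P ≤ Q → (P.map f).IsPrime ∧ (P.map f).comap f = P)
    {k : ℕ} {P : Ideal R} (h : RegularFlag Q k P) : RegularFlag Q' k (P.map f) := by
  induction h with
  | bot => rw [Ideal.map_bot]; exact .bot
  | @cons k P P' s _ hP hP' hle hPQ hs hsP hgen ih =>
    refine .cons ih (hprime P hP (hle.trans hPQ)).1 (hprime P' hP' hPQ).1 (Ideal.map_mono hle)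
      ((Ideal.map_mono hPQ).trans hQ) (Ideal.mem_map_of_mem f hs) (fun hs' => hsP ?_)
      (s := f s) fun x hx => ?_
    · rw [← (hprime P hP (hle.trans hPQ)).2]; exact hs'
    · refine Submodule.span_induction
        (p := fun x _ => ∃ t ∉ Q', t * x ∈ P.map f ⊔ Ideal.span {f s}) ?_ ?_ ?_ ?_ hx
      · rintro _ ⟨y, hy, rfl⟩
        obtain ⟨t, ht, hty⟩ := hgen y hy
        have := Ideal.mem_map_of_mem f hty
        rw [Ideal.map_sup, Ideal.map_span, Set.image_singleton, map_mul] at this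
        exact ⟨f t, hcompl t ht, this⟩
      · exact ⟨1, hQ'.one_notMem, by simp⟩
      · rintro x y _ _ ⟨t, ht, hx⟩ ⟨u, hu, hy⟩
        refine ⟨t * u, fun h => (hQ'.mem_or_mem h).elim ht hu, ?_⟩
        rw [show t * u * (x + y) = u * (t * x) + t * (u * y) by ring]
        exact Ideal.add_mem _ (Ideal.mul_mem_left _ _ hx) (Ideal.mul_mem_left _ _ hy)
      · rintro c x _ ⟨t, ht, hx⟩
        refine ⟨t, ht, ?_⟩
        rw [smul_eq_mul, mul_left_comm]; exact Ideal.mul_mem_left _ _ hx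

theorem HasRegularFlags.of_ringEquiv {R R' : Type*} [CommRing R] [CommRing R'] (e : R ≃+* R')
    (h : HasRegularFlags R) : HasRegularFlags R' := by
  intro Q _
  obtain ⟨k, hk⟩ := h (Q.comap (e : R →+* R')) inferInstance
  have hmap : (Q.comap (e : R →+* R')).map (e : R →+* R') = Q :=
    Ideal.map_comap_of_surjective _ e.surjective Q
  refine ⟨k, ?_⟩
  have := hk.map (e : R →+* R') (Q' := Q) hmap.le (fun t ht => ht) fun P hP _ =>
    ⟨Ideal.map_isPrime_of_equiv e, Ideal.comap_map_of_bijective _ e.bijective⟩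
  rwa [hmap] at this

theorem HasRegularFlags.of_field (K : Type*) [Field K] : HasRegularFlags K := by
  intro Q hQ
  rw [(Ideal.eq_bot_or_top Q).resolve_right hQ.ne_top]
  exact ⟨0, .bot⟩

open Polynomial in
-- If `Q` is not extended from `q = Q ∩ R`, take `s ∈ Q` of least degree outside `q[X]`. Minimality
-- keeps its leading coefficient out of `Q`, so pseudo-division by `s` shows that one more step
-- leads from `q[X]` to `Q`.
theorem HasRegularFlags.polynomial {R : Type*} [CommRing R] [IsDomain R]
    (h : HasRegularFlags R) : HasRegularFlags R[X] := by
  classical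
  intro Q hQ
  obtain ⟨k, hk⟩ := h (Q.comap C) inferInstance
  have hle : (Q.comap C).map C ≤ Q := Ideal.map_comap_le
  have hk' := hk.map C (Q' := Q) hle (fun t ht => ht) fun P hP _ =>
    ⟨Ideal.isPrime_map_C_of_isPrime, by
      ext x
      rw [Ideal.mem_comap, Ideal.mem_map_C_iff]
      refine ⟨fun hx => by simpa using hx 0, fun hx n => ?_⟩
      rw [coeff_C]; split_ifs
      exacts [hx, P.zero_mem]⟩
  by_cases heq : (Q.comap C).map C = Q
  · exact ⟨k, by rwa [heq] at hk'⟩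
  have hex : ∃ d, ∃ s ∈ Q, s ∉ (Q.comap C).map C ∧ s.natDegree = d := by
    by_contra! hcon
    exact heq (le_antisymm hle fun s hs => by_contra fun hs' => hcon _ s hs hs' rfl)
  obtain ⟨s, hs, hsP, hdeg⟩ := Nat.find_spec hex
  have hmin : ∀ x ∈ Q, x.natDegree < s.natDegree → x ∈ (Q.comap C).map C := fun x hx hlt =>
    by_contra fun hx' => Nat.find_min hex (hdeg ▸ hlt) ⟨x, hx, hx', rfl⟩
  have hpos : 0 < s.natDegree := by
    by_contra h0
    rw [Nat.pos_iff_ne_zero, not_not] at h0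
    rw [eq_C_of_natDegree_eq_zero h0] at hs hsP
    exact hsP (Ideal.mem_map_of_mem C hs)
  have hlead : C s.leadingCoeff ∉ Q := by
    intro hmem
    have hterm : C s.leadingCoeff * X ^ s.natDegree ∈ (Q.comap C).map C :=
      Ideal.mul_mem_right _ _ (Ideal.mem_map_of_mem C hmem)
    have herase : s.eraseLead ∈ (Q.comap C).map C := by
      rcases s.eraseLead_natDegree_lt_or_eraseLead_eq_zero with hlt | h0
      · exact hmin _ (by
          rw [← add_sub_cancel_right s.eraseLead, s.eraseLead_add_C_mul_X_pow]
          exact sub_mem hs (hle hterm)) hlt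
      · exact h0 ▸ Ideal.zero_mem _
    exact hsP (s.eraseLead_add_C_mul_X_pow ▸ Ideal.add_mem _ herase hterm)
  refine ⟨k + 1, .cons hk' Ideal.isPrime_map_C_of_isPrime hQ hle le_rfl hs hsP ?_⟩
  have hred : ∀ d, ∀ x ∈ Q, x.natDegree < d →
      ∃ t ∉ Q, t * x ∈ (Q.comap C).map C ⊔ Ideal.span {s} := by
    intro d
    induction d with
    | zero => intro x _ hd; exact absurd hd (Nat.not_lt_zero _)
    | succ d ih =>
      intro x hx hd
      by_cases hlt : x.natDegree < s.natDegree
      · exact ⟨1, hQ.one_notMem, by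
          rw [one_mul]; exact Ideal.mem_sup_left (hmin x hx hlt)⟩
      · push Not at hlt
        set r := C s.leadingCoeff * x - C x.leadingCoeff * X ^ (x.natDegree - s.natDegree) * s
          with hr
        have hrQ : r ∈ Q := sub_mem (Ideal.mul_mem_left _ _ hx) (Ideal.mul_mem_left _ _ hs)
        have hrx : r = s.cancelLeads x := by
          rw [cancelLeads, Nat.sub_eq_zero_of_le hlt, pow_zero, mul_one]
        obtain ⟨t, ht, htr⟩ := ih r hrQ ((hrx ▸ natDegree_cancelLeads_lt_of_natDegree_le_natDegree
          hlt (hpos.trans_le hlt)).trans_le (Nat.lt_succ_iff.1 hd))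
        refine ⟨t * C s.leadingCoeff, fun h => (hQ.mem_or_mem h).elim ht hlead, ?_⟩
        have : t * C s.leadingCoeff * x
            = t * r + t * (C x.leadingCoeff * X ^ (x.natDegree - s.natDegree)) * s := by
          rw [hr]; ring
        rw [this]
        exact Ideal.add_mem _ htr
          (Ideal.mem_sup_right (Ideal.mul_mem_left _ _ (Ideal.mem_span_singleton_self s)))
  exact fun x hx => hred _ x hx (Nat.lt_succ_self _)

theorem HasRegularFlags.mvPolynomial (K : Type*) [Field K] (n : ℕ) :
    HasRegularFlags (MvPolynomial (Fin n) K) := by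
  induction n with
  | zero => exact (HasRegularFlags.of_field K).of_ringEquiv (MvPolynomial.isEmptyRingEquiv K _).symm
  | succ n ih => exact ih.polynomial.of_ringEquiv (MvPolynomial.finSuccEquiv K n).toRingEquiv.symm

/-! ### Flags in local rings -/

section LocalRing

open IsLocalRing

variable {R : Type*} [CommRing R] [IsLocalRing R]

theorem RegularFlag.le {R : Type*} [CommRing R] {Q P : Ideal R} {k : ℕ} (h : RegularFlag Q k P) :
    P ≤ Q := by
  cases h with
  | bot => exact bot_le
  | cons _ _ _ _ h => exact h

/-- The multipliers outside the maximal ideal are units, so they can be cancelled. -/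
theorem RegularFlag.exists_sup_span {k : ℕ} {P' : Ideal R}
    (h : RegularFlag (maximalIdeal R) (k + 1) P') :
    ∃ (P : Ideal R) (s : R), RegularFlag (maximalIdeal R) k P ∧ P.IsPrime ∧ s ∉ P ∧
      P' = P ⊔ Ideal.span {s} := by
  cases h with
  | @cons _ P _ s h hP _ hle _ hs hsP hgen =>
    refine ⟨P, s, h, hP, hsP, le_antisymm (fun x hx => ?_)
      (sup_le hle ((Ideal.span_singleton_le_iff_mem _).2 hs))⟩
    obtain ⟨t, ht, htx⟩ := hgen x hx
    have hu : IsUnit t := by rwa [mem_maximalIdeal, mem_nonunits_iff, not_not] at ht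
    exact (Ideal.unit_mul_mem_iff_mem _ hu).1 htx

theorem RegularFlag.exists_span_singleton {P : Ideal R}
    (h : RegularFlag (maximalIdeal R) 1 P) : ∃ s, s ≠ 0 ∧ P = Ideal.span {s} := by
  obtain ⟨P₀, s, h₀, -, hs, rfl⟩ := h.exists_sup_span
  cases h₀
  exact ⟨s, by simpa using hs, by simp⟩

theorem RegularFlag.exists_span_pair {P : Ideal R} (h : RegularFlag (maximalIdeal R) 2 P) :
    ∃ s₁ s₂, s₁ ≠ 0 ∧ (∀ z, s₁ ∣ s₂ * z → s₁ ∣ z) ∧ P = Ideal.span {s₁, s₂} := by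
  obtain ⟨P₁, s₂, h₁, hP₁, hs₂, rfl⟩ := h.exists_sup_span
  obtain ⟨s₁, hs₁, rfl⟩ := h₁.exists_span_singleton
  refine ⟨s₁, s₂, hs₁, fun z hz => ?_, by rw [Ideal.span_insert]⟩
  rw [← Ideal.mem_span_singleton] at hz ⊢
  exact (hP₁.mem_or_mem hz).resolve_left hs₂

/-- Each term of the flag is prime, so the next generator is a nonzerodivisor modulo it; terms above
the third are discarded. -/
theorem RegularFlag.exists_regular_triple {k : ℕ} {P : Ideal R}
    (h : RegularFlag (maximalIdeal R) (k + 3) P) :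
    ∃ s₁ s₂ s₃, s₁ ∈ maximalIdeal R ∧ s₂ ∈ maximalIdeal R ∧ s₃ ∈ maximalIdeal R ∧ s₁ ≠ 0 ∧
      (∀ z, s₁ ∣ s₂ * z → s₁ ∣ z) ∧
      ∀ z, s₃ * z ∈ Ideal.span {s₁, s₂} → z ∈ Ideal.span {s₁, s₂} := by
  induction k generalizing P with
  | zero =>
    have hle := h.le
    obtain ⟨P₂, s₃, h₂, hP₂, hs₃, rfl⟩ := h.exists_sup_span
    obtain ⟨s₁, s₂, hs₁, hreg, rfl⟩ := h₂.exists_span_pair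
    exact ⟨s₁, s₂, s₃, h₂.le (Ideal.subset_span (by simp)), h₂.le (Ideal.subset_span (by simp)),
      hle (Ideal.mem_sup_right (Ideal.mem_span_singleton_self _)), hs₁, hreg,
      fun z hz => (hP₂.mem_or_mem hz).resolve_left hs₃⟩
  | succ k ih =>
    obtain ⟨P', -, h', -⟩ := h.exists_sup_span
    exact ih h'

/-- A local ring with a regular flag whose maximal ideal is associated to a weakly regular sequence
of length two has its maximal ideal generated by a weakly regular sequence of length two. -/
theorem RegularFlag.exists_maximalIdeal_eq_span_pair [IsDomain R] {k : ℕ}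
    (h : RegularFlag (maximalIdeal R) k (maximalIdeal R)) {a b g : R} (ha : a ∈ maximalIdeal R)
    (hb : b ∈ maximalIdeal R) (ha0 : a ≠ 0) (hab : ∀ z, a ∣ b * z → a ∣ z)
    (hg : g ∉ Ideal.span {a, b}) (hmg : ∀ x ∈ maximalIdeal R, x * g ∈ Ideal.span {a, b}) :
    ∃ s₁ s₂, s₁ ≠ 0 ∧ (∀ z, s₁ ∣ s₂ * z → s₁ ∣ z) ∧ maximalIdeal R = Ideal.span {s₁, s₂} := by
  match k, h with
  | 0, h =>
    generalize maximalIdeal R = m at h ha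
    cases h
    exact absurd ha ha0
  | 1, h =>
    exfalso
    obtain ⟨s, hs0, hs⟩ := h.exists_span_singleton
    have hsm : s ∈ maximalIdeal R := hs ▸ Ideal.mem_span_singleton_self s
    obtain ⟨a', rfl⟩ := Ideal.mem_span_singleton.1 (hs ▸ ha)
    obtain ⟨b', rfl⟩ := Ideal.mem_span_singleton.1 (hs ▸ hb)
    -- Since `s b' a' = a b'`, regularity gives `a = s a' ∣ a'`, making `s` a unit.
    obtain ⟨c, hc⟩ := hab a' ⟨b', by ring⟩
    refine (mem_maximalIdeal _).1 hsm (IsUnit.of_mul_eq_one c ?_)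
    apply mul_left_cancel₀ (right_ne_zero_of_mul ha0)
    linear_combination -hc
  | 2, h => exact h.exists_span_pair
  -- Depth at least three leaves no room for `g`, which the maximal ideal kills modulo `(a, b)`.
  | k + 3, h =>
    obtain ⟨s₁, s₂, s₃, hs₁, hs₂, hs₃, hs0, hreg₂, hreg₃⟩ := h.exists_regular_triple
    have hb0 : b ≠ 0 := by
      rintro rfl
      exact (mem_maximalIdeal _).1 ha (isUnit_of_dvd_one (hab 1 (by simp)))
    exact absurd (mem_span_pair_of_regular_triple ha0 hb0 hs0 hab hreg₂ hreg₃ (hmg _ hs₁)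
      (hmg _ hs₂) (hmg _ hs₃)) hg

/-- By Krull the maximal ideal has height at most two, so it is the only prime above `J`; a radical
ideal is the intersection of the primes above it. -/
theorem eq_maximalIdeal_of_isRadical_of_height [IsNoetherianRing R] {J : Ideal R} {s₁ s₂ : R}
    (hm : maximalIdeal R = Ideal.span {s₁, s₂}) (hJ : J.IsRadical) (hJm : J ≤ maximalIdeal R)
    (hheight : ∀ p : Ideal R, p.IsPrime → J ≤ p → 2 ≤ p.height) : J = maximalIdeal R := by
  classical
  have hm2 : (maximalIdeal R).height ≤ 2 := by
    have := Ideal.height_le_card_of_mem_minimalPrimes_span_finset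
      (p := maximalIdeal R) (s := {s₁, s₂}) (by
        rw [Finset.coe_pair, ← hm, Ideal.minimalPrimes_eq_subsingleton_self]; rfl)
    exact this.trans (by exact_mod_cast Finset.card_le_two)
  refine le_antisymm hJm (le_trans ?_ hJ)
  rw [Ideal.radical_eq_sInf]
  refine le_sInf fun p ⟨hJp, hp⟩ => ?_
  by_contra hcon
  have hlt : p < maximalIdeal R :=
    lt_of_le_of_ne (le_maximalIdeal hp.ne_top) fun h => hcon h.ge
  have h1 := (Ideal.height_add_one_le_of_lt_of_isPrime hlt).trans hm2
  have h2 := (add_le_add_left (hheight p hp hJp) 1).trans h1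
  exact absurd h2 (by decide)

end LocalRing

/-! ### The division theorem -/

theorem contraction_wedge {R ι : Type*} [CommRing R] [Fintype ι] {A η : ι → R} {θ : ι → ι → R}
    (h : ∀ i j, θ i j = A i * η j - A j * η i) (X Y : ι → R) :
    ∑ i, ∑ j, X i * Y j * θ i j
      = (∑ j, Y j * η j) * (∑ i, X i * A i) - (∑ i, X i * η i) * ∑ j, Y j * A j := by
  have e : ∀ i j, X i * Y j * θ i j = Y j * η j * (X i * A i) - X i * η i * (Y j * A j) :=
    fun i j => by rw [h]; ring
  simp only [e, Finset.sum_sub_distrib]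
  rw [Finset.sum_mul_sum, Finset.sum_mul_sum, Finset.sum_comm]

/-- An ideal contained in no prime of height at most one of a factorial ring contains a regular
sequence of length two. -/
theorem exists_regular_pair {S : Type*} [CommRing S] [IsDomain S] [IsNoetherianRing S]
    [UniqueFactorizationMonoid S] {J : Ideal S} (hJ0 : J ≠ ⊥)
    (hheight : ∀ p : Ideal S, p.IsPrime → J ≤ p → 2 ≤ p.height) :
    ∃ a ∈ J, ∃ b ∈ J, a ≠ 0 ∧ ∀ z, a ∣ b * z → a ∣ z := by
  classical
  obtain ⟨a, haJ, ha0⟩ := Submodule.exists_mem_ne_zero_of_ne_bot hJ0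
  let F : Finset S := (UniqueFactorizationMonoid.factors a).toFinset
  have hF : ∀ π ∈ F, Prime π := fun π hπ =>
    UniqueFactorizationMonoid.prime_of_factor π (Multiset.mem_toFinset.1 hπ)
  have hprime : ∀ π ∈ F, (Ideal.span {π}).IsPrime := fun π hπ =>
    (Ideal.span_singleton_prime (hF π hπ).ne_zero).2 (hF π hπ)
  have hnot : ¬ (J : Set S) ⊆ ⋃ π ∈ (F : Set S), (Ideal.span {π} : Ideal S) := by
    intro hsub
    obtain ⟨π, hπ, hle⟩ := (Ideal.subset_union_prime 0 0 fun π hπ _ _ => hprime π hπ).1 hsub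
    have h1 := Ideal.height_span_singleton_le_one (hF π hπ).not_isUnit
    exact absurd ((hheight _ (hprime π hπ) hle).trans h1) (by decide)
  obtain ⟨b, hbJ, hb⟩ := Set.not_subset.1 hnot
  refine ⟨a, haJ, b, hbJ, ha0, fun z hz => ?_⟩
  refine UniqueFactorizationMonoid.dvd_of_dvd_mul_left_of_no_prime_factors ha0
    (fun d hda hdb hd => hb ?_) (mul_comm b z ▸ hz)
  obtain ⟨π, hπ, hassoc⟩ := UniqueFactorizationMonoid.exists_mem_factors_of_dvd ha0
    hd.irreducible hda
  exact Set.mem_biUnion (Finset.mem_coe.2 (Multiset.mem_toFinset.2 hπ))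
    (Ideal.mem_span_singleton.2 (hassoc.symm.dvd.trans hdb))

/-- Division of 2-forms: if the coefficients of the 1-form `A` generate a radical ideal `J`
contained in no prime of height at most one, every 2-form `θ` with coefficients in `J` and
`A ∧ θ = 0` is a multiple of `A`. -/
theorem exists_wedge_of_mem_of_isRadical {S ι : Type*} [CommRing S] [IsDomain S]
    [IsNoetherianRing S] [UniqueFactorizationMonoid S] (hflag : HasRegularFlags S) [Fintype ι]
    {A : ι → S} {θ : ι → ι → S} (hskew : ∀ i j, θ i j = -θ j i)
    (hcyc : ∀ i j k, A i * θ j k - A j * θ i k + A k * θ i j = 0) (hA : A ≠ 0)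
    (hJ : (Ideal.span (Set.range A)).IsRadical)
    (hheight : ∀ p : Ideal S, p.IsPrime → Ideal.span (Set.range A) ≤ p → 2 ≤ p.height)
    (hθ : ∀ i j, θ i j ∈ Ideal.span (Set.range A)) :
    ∃ η : ι → S, ∀ i j, θ i j = A i * η j - A j * η i := by
  set J := Ideal.span (Set.range A) with hJdef
  have hAJ : ∀ i, A i ∈ J := fun i => Ideal.subset_span ⟨i, rfl⟩
  have hJ0 : J ≠ ⊥ := by
    obtain ⟨i, hi⟩ := Function.ne_iff.1 hA
    exact fun h => hi (by simpa [h] using hAJ i)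
  obtain ⟨a, haJ, b, hbJ, ha0, hab⟩ := exists_regular_pair hJ0 hheight
  obtain ⟨X, hX⟩ := Ideal.mem_span_range_iff_exists_fun.1 haJ
  obtain ⟨Y, hY⟩ := Ideal.mem_span_range_iff_exists_fun.1 hbJ
  refine exists_wedge_of_contraction_mem hskew hcyc hX.symm hY.symm ha0 hab ?_
  set g := ∑ i, ∑ j, X i * Y j * θ i j with hg
  by_contra hgI
  -- The cyclic identity reads `A k θ = A ∧ θ k`; contract it with `X` and `Y`.
  have hAg : ∀ k, A k * g ∈ Ideal.span {a, b} := by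
    intro k
    have := contraction_wedge (A := A) (η := θ k) (θ := fun i j => A k * θ i j)
      (fun i j => by linear_combination hcyc k i j) X Y
    simp only [mul_left_comm _ (A k), ← Finset.mul_sum] at this
    rw [hX, hY, ← hg] at this
    exact Ideal.mem_span_pair.2 ⟨∑ j, Y j * θ k j, -∑ i, X i * θ k i, by rw [this]; ring⟩
  have hJg : ∀ x ∈ J, x * g ∈ Ideal.span {a, b} := by
    intro x hx
    have hle : J ≤ (Ideal.span {a, b}).colon {g} := Ideal.span_le.2 (by
      rintro _ ⟨k, rfl⟩
      exact Submodule.mem_colon_singleton.2 (hAg k))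
    exact Submodule.mem_colon_singleton.1 (hle hx)
  obtain ⟨Q, hassoc, hle⟩ := exists_le_isAssociatedPrime_of_isNoetherianRing S
    (Ideal.Quotient.mk (Ideal.span {a, b}) g) (by rwa [Ne, Ideal.Quotient.eq_zero_iff_mem])
  obtain ⟨hQ, y, hy⟩ := Submodule.isAssociatedPrime_iff.1 hassoc
  obtain ⟨g', rfl⟩ := Ideal.Quotient.mk_surjective y
  have hcolon : ∀ x f, x ∈ (⊥ : Submodule S (S ⧸ Ideal.span {a, b})).colon
      {Ideal.Quotient.mk (Ideal.span {a, b}) f} ↔ x * f ∈ Ideal.span {a, b} := by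
    intro x f
    rw [Submodule.mem_colon_singleton, Submodule.mem_bot, ← Ideal.Quotient.eq_zero_iff_mem,
      map_mul]
    rfl
  have hgQ : ∀ x, x * g ∈ Ideal.span {a, b} → x ∈ Q := fun x hx => hle ((hcolon x g).2 hx)
  have hg'Q : ∀ x, x ∈ Q ↔ x * g' ∈ Ideal.span {a, b} := fun x => by rw [hy, hcolon]
  have hJQ : J ≤ Q := fun x hx => hgQ x (hJg x hx)
  set R := Localization.AtPrime Q
  set f := algebraMap S R
  have hinj : Function.Injective f := IsLocalization.injective R Q.primeCompl_le_nonZeroDivisors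
  have hunit : ∀ t ∉ Q, IsUnit (f t) := fun t ht =>
    IsLocalization.map_units R (⟨t, ht⟩ : Q.primeCompl)
  have hmap : Q.map f = IsLocalRing.maximalIdeal R := Localization.AtPrime.map_eq_maximalIdeal
  have hmem : ∀ I : Ideal S, ∀ x, f x ∈ I.map f → ∃ t ∉ Q, t * x ∈ I := by
    intro I x hx
    obtain ⟨t, ht, htx⟩ := (IsLocalization.algebraMap_mem_map_algebraMap_iff Q.primeCompl R I x).1 hx
    exact ⟨t, ht, htx⟩
  have hpair : (Ideal.span {a, b}).map f = Ideal.span {f a, f b} := by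
    rw [Ideal.map_span, Set.image_pair]
  have hJmap : J.map f = Ideal.span (Set.range fun i => f (A i)) := by
    rw [hJdef, Ideal.map_span, ← Set.range_comp]; rfl
  obtain ⟨k, hk⟩ := hflag Q hQ
  have hflagR := hk.map f (Q' := IsLocalRing.maximalIdeal R) hmap.le
    (fun t ht h => (IsLocalRing.mem_maximalIdeal _).1 h (hunit t ht)) fun P hP hPQ => by
      have hdisj : Disjoint (Q.primeCompl : Set S) P :=
        Set.disjoint_left.2 fun t ht htP => ht (hPQ htP)
      exact ⟨IsLocalization.isPrime_of_isPrime_disjoint Q.primeCompl R P hP hdisj,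
        IsLocalization.under_map_of_isPrime_disjoint Q.primeCompl R hP hdisj⟩
  rw [hmap] at hflagR
  have hfa0 : f a ≠ 0 := fun h => ha0 (hinj (h.trans (map_zero f).symm))
  have hfab : ∀ z, f a ∣ f b * z → f a ∣ z := by
    intro z hz
    obtain ⟨⟨z', t⟩, ht⟩ := IsLocalization.surj Q.primeCompl z
    have hz' : f (b * z') ∈ (Ideal.span {a}).map f := by
      rw [Ideal.map_span, Set.image_singleton, Ideal.mem_span_singleton, map_mul, ← ht, ← mul_assoc]
      exact hz.mul_right _
    obtain ⟨u, hu, huz⟩ := hmem _ _ hz'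
    rw [Ideal.mem_span_singleton, mul_left_comm] at huz
    have h1 := map_dvd f (hab _ huz)
    rw [map_mul, ← ht] at h1
    exact (hunit t t.2).dvd_mul_right.1 ((hunit u hu).dvd_mul_left.1 h1)
  obtain ⟨s₁, s₂, hs0, hsreg, hm⟩ := hflagR.exists_maximalIdeal_eq_span_pair
    (hmap ▸ Ideal.mem_map_of_mem f (hJQ haJ)) (hmap ▸ Ideal.mem_map_of_mem f (hJQ hbJ)) hfa0 hfab
    (g := f g') (fun h => by
      obtain ⟨t, ht, htg⟩ := hmem _ _ (hpair ▸ h)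
      exact ht ((hg'Q t).2 htg))
    (fun x hx => by
      have hle : IsLocalRing.maximalIdeal R ≤ (Ideal.span {f a, f b}).colon {f g'} := by
        rw [← hmap, Ideal.map_le_iff_le_comap]
        intro x hx
        rw [Ideal.mem_comap, Submodule.mem_colon_singleton, ← hpair, smul_eq_mul, ← map_mul]
        exact Ideal.mem_map_of_mem f ((hg'Q x).1 hx)
      exact Submodule.mem_colon_singleton.1 (hle hx))
  have hJm : J.map f = IsLocalRing.maximalIdeal R := by
    refine eq_maximalIdeal_of_isRadical_of_height hm ?_ (hmap ▸ Ideal.map_mono hJQ) fun p hp hle => ?_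
    · rw [← Ideal.radical_eq_iff, ← IsLocalization.map_radical Q.primeCompl, hJ.radical]
    · rw [← IsLocalization.height_under Q.primeCompl p]
      exact hheight _ inferInstance (Ideal.map_le_iff_le_comap.1 hle)
  have hs₁ : s₁ ∈ J.map f := hJm ▸ hm ▸ Ideal.subset_span (by simp)
  have hs₂ : s₂ ∈ J.map f := hJm ▸ hm ▸ Ideal.subset_span (by simp)
  rw [hJmap] at hs₁ hs₂
  obtain ⟨X', hX'⟩ := Ideal.mem_span_range_iff_exists_fun.1 hs₁
  obtain ⟨Y', hY'⟩ := Ideal.mem_span_range_iff_exists_fun.1 hs₂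
  -- Over `S_Q` the pair `s₁, s₂` generates the extension of `J`, which contains every coefficient
  -- of `θ`.
  obtain ⟨η, hη⟩ := exists_wedge_of_contraction_mem (A := fun i => f (A i))
    (θ := fun i j => f (θ i j)) (fun i j => by rw [hskew, map_neg])
    (fun i j k => by simpa using congrArg f (hcyc i j k)) hX'.symm hY'.symm hs0 hsreg (by
      rw [← hm, ← hJm]
      exact Ideal.sum_mem _ fun i _ => Ideal.sum_mem _ fun j _ =>
        Ideal.mul_mem_left _ _ (Ideal.mem_map_of_mem f (hθ i j)))
  have hfg := contraction_wedge hη (fun i => f (X i)) (fun i => f (Y i))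
  have hfg' : f g ∈ (Ideal.span {a, b}).map f := by
    rw [hpair, Ideal.mem_span_pair]
    refine ⟨∑ j, f (Y j) * η j, -∑ i, f (X i) * η i, ?_⟩
    simp only [hg, ← hX, ← hY, map_sum, map_mul]
    rw [hfg]; ring
  obtain ⟨t, ht, htg⟩ := hmem _ _ hfg'
  exact ht (hgQ t htg)

/-! ### Forms in coordinates -/

open MvPolynomial

theorem eq_sum_coefficient_smul {n : ℕ} (ω : Form1 n) :
    ω = ∑ i, coefficient ω i • diff (X i : S n) := by
  conv_lhs => rw [← (KaehlerDifferential.mvPolynomialBasis ℂ (Fin (n + 1))).sum_repr ω]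
  simp only [KaehlerDifferential.mvPolynomialBasis_apply]
  rfl

theorem coefficient_diff {n : ℕ} (f : S n) (i : Fin (n + 1)) :
    coefficient (diff f) i = pderiv i f :=
  KaehlerDifferential.mvPolynomialBasis_repr_apply ℂ _ f i

theorem contract_eq_sum {n : ℕ} (ω : Form1 n) (D : Derivation ℂ (S n) (S n)) :
    contract ω D = ∑ i, coefficient ω i * D (X i) := by
  change D.liftKaehlerDifferential ω = _
  conv_lhs => rw [eq_sum_coefficient_smul ω]
  rw [map_sum]
  refine Finset.sum_congr rfl fun i _ => ?_
  rw [map_smul, smul_eq_mul, diff, Derivation.liftKaehlerDifferential_comp_D]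

theorem singularIdeal_eq_span {n : ℕ} (ω : Form1 n) :
    singularIdeal ω = Ideal.span (Set.range (coefficient ω)) := by
  ext f
  rw [Ideal.mem_span_range_iff_exists_fun]
  constructor
  · rintro ⟨D, rfl⟩
    exact ⟨fun i => D (X i), by simp only [contract_eq_sum, mul_comm]⟩
  · rintro ⟨c, rfl⟩
    exact ⟨mkDerivation ℂ c, by simp only [contract_eq_sum, mkDerivation_X, mul_comm]⟩

/-- The `k`-form sending `k` covectors to their minor on the given columns. -/
noncomputable def minor {n k : ℕ} (c : Fin k → Fin (n + 1)) : Form1 n [⋀^Fin k]→ₗ[S n] S n :=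
  Matrix.detRowAlternating.compLinearMap
    (LinearMap.pi fun a => (KaehlerDifferential.mvPolynomialBasis ℂ (Fin (n + 1))).coord (c a))

theorem minor_apply {n k : ℕ} (c : Fin k → Fin (n + 1)) (v : Fin k → Form1 n) :
    minor c v = Matrix.det (Matrix.of fun a b => coefficient (v a) (c b)) := rfl

/-- The coefficients `∂ᵢAⱼ - ∂ⱼAᵢ` of `dω`. -/
noncomputable def curl {n : ℕ} (ω : Form1 n) (i j : Fin (n + 1)) : S n :=
  pderiv i (coefficient ω j) - pderiv j (coefficient ω i)

theorem minor_extDiff {n : ℕ} (ω : Form1 n) (i j : Fin (n + 1)) :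
    exteriorPower.alternatingMapLinearEquiv (minor ![i, j]) (extDiff ω) = curl ω i j := by
  classical
  simp only [extDiff, map_sum, exteriorPower.alternatingMapLinearEquiv_apply_ιMulti, minor_apply,
    Matrix.det_fin_two]
  simp [coefficient_diff, pderiv_X, Pi.single_apply, curl]

theorem curl_cyclic {n : ℕ} {ω : Form1 n}
    (h : ExteriorAlgebra.ι (S n) ω * (extDiff ω : Forms n) = 0) (i j k : Fin (n + 1)) :
    coefficient ω i * curl ω j k - coefficient ω j * curl ω i k + coefficient ω k * curl ω i j
      = 0 := by
  classical
  -- `Pi.single 3` reads off the `dxᵢ ∧ dxⱼ ∧ dxₖ` coefficient and vanishes in the other degrees.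
  have h0 := congrArg (ExteriorAlgebra.liftAlternating (R := S n)
    (Pi.single 3 (minor ![i, j, k]))) h
  have hprod : ∀ l, ExteriorAlgebra.ι (S n) ω * ExteriorAlgebra.ιMulti (S n) 2
      ![diff (coefficient ω l), diff (X l)]
      = ExteriorAlgebra.ιMulti (S n) 3 ![ω, diff (coefficient ω l), diff (X l)] := by
    intro l
    simp [ExteriorAlgebra.ιMulti_apply]
  rw [map_zero, extDiff, Submodule.coe_sum, Finset.mul_sum, map_sum] at h0
  simp only [exteriorPower.ιMulti_apply_coe, hprod, ExteriorAlgebra.liftAlternating_apply_ιMulti,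
    Pi.single_eq_same, minor_apply, Matrix.det_fin_three] at h0
  simp [coefficient_diff, pderiv_X, Pi.single_apply, Finset.sum_add_distrib] at h0
  rw [← h0, curl, curl, curl]
  ring

/-- The matrix `h ∂ᵢAⱼ - Aᵢηⱼ` is symmetric, so its pairing with `dxᵢ ∧ dxⱼ` equals its own
negative, and 2 is invertible. -/
theorem mem_unfoldingIdeal_of_curl {n : ℕ} {ω : Form1 n} {h : S n} {η : Fin (n + 1) → S n}
    (hη : ∀ i j, h * curl ω i j = coefficient ω i * η j - coefficient ω j * η i) :
    h ∈ unfoldingIdeal ω := by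
  classical
  refine ⟨∑ j, η j • diff (X j), ?_⟩
  set e : Fin (n + 1) → Forms n := fun i => ExteriorAlgebra.ι (S n) (diff (X i)) with he
  have hanti : ∀ i j, e j * e i = -(e i * e j) := fun i j =>
    eq_neg_of_add_eq_zero_left (ExteriorAlgebra.ι_add_mul_swap _ _)
  have hdω : (extDiff ω : Forms n) = ∑ i, ∑ j, pderiv i (coefficient ω j) • (e i * e j) := by
    rw [extDiff, Submodule.coe_sum, Finset.sum_comm]
    refine Finset.sum_congr rfl fun j _ => ?_
    have : (exteriorPower.ιMulti (S n) 2 ![diff (coefficient ω j), diff (X j)] : Forms n)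
        = ExteriorAlgebra.ι (S n) (diff (coefficient ω j)) * e j := by
      simp [ExteriorAlgebra.ιMulti_apply, he]
    rw [this, eq_sum_coefficient_smul (diff (coefficient ω j)), map_sum, Finset.sum_mul]
    exact Finset.sum_congr rfl fun i _ => by rw [map_smul, smul_mul_assoc, coefficient_diff]
  have hωη : ExteriorAlgebra.ι (S n) ω * ExteriorAlgebra.ι (S n) (∑ j, η j • diff (X j))
      = ∑ i, ∑ j, (coefficient ω i * η j) • (e i * e j) := by
    conv_lhs => rw [eq_sum_coefficient_smul ω]
    simp only [map_sum, map_smul, Finset.sum_mul_sum, smul_mul_smul_comm, he]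
  set M : Fin (n + 1) → Fin (n + 1) → S n := fun i j =>
    h * pderiv i (coefficient ω j) - coefficient ω i * η j with hM
  have hMs : ∀ i j, M i j = M j i := by
    intro i j
    have := hη i j
    rw [curl] at this
    simp only [hM]
    linear_combination this
  have hdiff : h • (extDiff ω : Forms n)
      - ExteriorAlgebra.ι (S n) ω * ExteriorAlgebra.ι (S n) (∑ j, η j • diff (X j))
      = ∑ i, ∑ j, M i j • (e i * e j) := by
    simp only [hdω, hωη, Finset.smul_sum, smul_smul, ← Finset.sum_sub_distrib, ← sub_smul, hM]
  have hneg : ∑ i, ∑ j, M i j • (e i * e j) = -∑ i, ∑ j, M i j • (e i * e j) := by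
    conv_lhs => rw [Finset.sum_comm]
    simp only [← Finset.sum_neg_distrib]
    refine Finset.sum_congr rfl fun i _ => Finset.sum_congr rfl fun j _ => ?_
    rw [hMs j i, hanti i j, smul_neg]
  have h2 : (2 : S n) • ∑ i, ∑ j, M i j • (e i * e j) = 0 := by
    rw [two_smul]
    nth_rewrite 2 [hneg]
    exact add_neg_cancel _
  have hunit : (C (1 / 2) : S n) * 2 = 1 := by
    rw [← map_ofNat C 2, ← map_mul]; norm_num
  rw [← sub_eq_zero, hdiff, ← one_smul (S n) (∑ i, ∑ j, M i j • (e i * e j)), ← hunit, mul_smul, h2,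
    smul_zero]

/-- The coefficient functionals of 2-forms, tensored with `S/J`, detect the vanishing of `h dω`
modulo `J`. -/
theorem mul_curl_mem_singularIdeal {n : ℕ} {ω : Form1 n} {h : S n} (hh : h ∈ kupkaIdeal ω)
    (i j : Fin (n + 1)) : h * curl ω i j ∈ singularIdeal ω := by
  obtain ⟨x, hx, y, hy, rfl⟩ := Submodule.mem_sup.1 hh
  rw [add_mul]
  refine Ideal.add_mem _ ?_ (Ideal.mul_mem_right _ _ hy)
  have h0 := congrArg (LinearMap.rTensor (S n ⧸ singularIdeal ω)
    (exteriorPower.alternatingMapLinearEquiv (minor ![i, j]))) ((Ideal.mem_torsionOf_iff _ _).1 hx)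
  rw [map_smul, LinearMap.rTensor_tmul, minor_extDiff, map_zero] at h0
  have h1 := congrArg (TensorProduct.lid (S n) (S n ⧸ singularIdeal ω)) h0
  rw [map_smul, TensorProduct.lid_tmul, map_zero, smul_smul] at h1
  rw [← Ideal.Quotient.eq_zero_iff_mem, ← h1]
  exact (mul_one _).symm

theorem unfoldingIdeal_le_kupkaIdeal {n : ℕ} (ω : Form1 n) :
    unfoldingIdeal ω ≤ kupkaIdeal ω := by
  rintro h ⟨η, hη⟩
  refine Ideal.mem_sup_left ((Ideal.mem_torsionOf_iff _ _).2 ?_)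
  have hform : h • extDiff ω
      = ∑ i, coefficient ω i • exteriorPower.ιMulti (S n) 2 ![diff (X i), η] := by
    apply Subtype.val_injective
    rw [Submodule.coe_smul, hη]
    conv_lhs => rw [eq_sum_coefficient_smul ω]
    rw [map_sum, Finset.sum_mul, Submodule.coe_sum]
    refine Finset.sum_congr rfl fun i _ => ?_
    simp [ExteriorAlgebra.ιMulti_apply]
  rw [TensorProduct.smul_tmul', hform, TensorProduct.sum_tmul]
  refine Finset.sum_eq_zero fun i _ => ?_
  rw [TensorProduct.smul_tmul]
  have : coefficient ω i • (1 : S n ⧸ singularIdeal ω) = 0 := by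
    refine (mul_one (Ideal.Quotient.mk (singularIdeal ω) (coefficient ω i))).trans
      (Ideal.Quotient.eq_zero_iff_mem.2 ?_)
    exact (singularIdeal_eq_span ω ▸ Ideal.subset_span ⟨i, rfl⟩)
  rw [this, TensorProduct.tmul_zero]

/-! ### Height of the singular ideal on the affine cone -/

theorem IsFoliation.coefficient_ne_zero {n e : ℕ} {ω : Form1 n} (hω : IsFoliation n e ω) :
    coefficient ω ≠ 0 := fun h => hω.ne_zero (by
  rw [eq_sum_coefficient_smul ω]
  exact Finset.sum_eq_zero fun i _ => by rw [h, Pi.zero_apply, zero_smul])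

theorem IsFoliation.pos {n e : ℕ} {ω : Form1 n} (hω : IsFoliation n e ω) : 0 < n := by
  rcases Nat.eq_zero_or_pos n with rfl | hn
  · exfalso
    have h := hω.descends
    rw [contract_eq_sum, Fin.sum_univ_one, radial, mkDerivation_X] at h
    refine hω.coefficient_ne_zero (funext fun i => ?_)
    rw [Fin.fin_one_eq_zero i]
    exact (mul_eq_zero.1 h).resolve_right (X_ne_zero _)
  · exact hn

theorem two_le_height_of_X_mem {n : ℕ} (hn : 0 < n) {p : Ideal (S n)} [p.IsPrime]
    (hp : ∀ i, (X i : S n) ∈ p) : 2 ≤ p.height := by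
  have hprime : (Ideal.span {(X 0 : S n)}).IsPrime :=
    (Ideal.span_singleton_prime (X_ne_zero _)).2 X_prime
  have h1 : (⊥ : Ideal (S n)) < Ideal.span {(X 0 : S n)} :=
    bot_lt_iff_ne_bot.2 fun h => X_ne_zero (R := ℂ) (0 : Fin (n + 1))
      (Ideal.span_singleton_eq_bot.1 h)
  have h2 : Ideal.span {(X 0 : S n)} < p := by
    refine lt_of_le_of_ne ((Ideal.span_singleton_le_iff_mem _).2 (hp 0)) fun h => ?_
    have := Ideal.mem_span_singleton.1 (h ▸ hp (Fin.last n))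
    rw [X_dvd_X] at this
    exact hn.ne (congrArg Fin.val this)
  have h3 := Ideal.height_add_one_le_of_lt_of_isPrime h1
  have h4 := Ideal.height_add_one_le_of_lt_of_isPrime h2
  rw [Ideal.height_bot, zero_add] at h3
  exact le_trans (by rw [← one_add_one_eq_two]; gcongr) h4

/-- `J` is homogeneous, so it lies in the homogeneous core of `p`, whose height is at most that of
`p`. The core is a point of `ℙⁿ`, where `codim` applies, or contains all the variables, of which
there are at least two. -/
theorem IsFoliation.two_le_height {n e : ℕ} {ω : Form1 n} (hω : IsFoliation n e ω)
    {p : Ideal (S n)} (hp : p.IsPrime) (hle : singularIdeal ω ≤ p) : 2 ≤ p.height := by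
  set 𝒜 := homogeneousSubmodule (Fin (n + 1)) ℂ
  have hcore : (p.homogeneousCore 𝒜).toIdeal.IsPrime := hp.homogeneousCore
  have hJ : singularIdeal ω ≤ (p.homogeneousCore 𝒜).toIdeal := by
    rw [singularIdeal_eq_span, Ideal.span_le]
    rintro _ ⟨i, rfl⟩
    exact Ideal.mem_homogeneousCore_of_homogeneous_of_mem ⟨e - 1, hω.homogeneous i⟩
      (hle (singularIdeal_eq_span ω ▸ Ideal.subset_span ⟨i, rfl⟩))
  refine le_trans ?_ (Ideal.height_mono (Ideal.toIdeal_homogeneousCore_le 𝒜 p))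
  by_cases hirr : HomogeneousIdeal.irrelevant 𝒜 ≤ p.homogeneousCore 𝒜
  · refine two_le_height_of_X_mem hω.pos fun i => hirr ?_
    exact HomogeneousIdeal.mem_irrelevant_of_mem 𝒜 one_pos (isHomogeneous_X ℂ i)
  · exact hω.codim ⟨p.homogeneousCore 𝒜, hcore, hirr⟩ hJ

end Foliation

theorem corollary4 (n e : ℕ) (ω : Foliation.Form1 n) (hω : Foliation.IsFoliation n e ω)
    (hJ : (Foliation.singularIdeal ω).IsRadical)
    (hKL : Foliation.projLocus (Foliation.kupkaIdeal ω) ∩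
      Foliation.projLocus (Foliation.nonKupkaIdeal ω) = ∅) :
    Foliation.unfoldingIdeal ω = Foliation.kupkaIdeal ω := by
  refine le_antisymm (Foliation.unfoldingIdeal_le_kupkaIdeal ω) fun h hh => ?_
  have hspan := Foliation.singularIdeal_eq_span ω
  obtain ⟨η, hη⟩ := Foliation.exists_wedge_of_mem_of_isRadical
    (Foliation.HasRegularFlags.mvPolynomial ℂ (n + 1)) (A := Foliation.coefficient ω)
    (θ := fun i j => h * Foliation.curl ω i j)
    (fun i j => by rw [Foliation.curl, Foliation.curl]; ring)
    (fun i j k => by linear_combination h * Foliation.curl_cyclic hω.integrable i j k)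
    hω.coefficient_ne_zero (hspan ▸ hJ)
    (fun p hp hle => hω.two_le_height hp (hspan.trans_le hle))
    (fun i j => hspan ▸ Foliation.mul_curl_mem_singularIdeal hh i j)
  exact Foliation.mem_unfoldingIdeal_of_curl hη
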